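/- Let $A$ be a commutative ring with $1$, and let $m<n$ be non-negative integers with $n\ge 3$. Let $\operatorname{Um}_{m,n}(A)$ be the set of unimodular $m\times n$ matrices over $A$, i.e. those $M$ for which there is an $n\times m$ matrix $N$ with $MN=I_m$. For $k\ge 0$ let $E_k(A)$ be the group generated by the elementary $k\times k$ matrices $e_{ij}(t)$, $i\ne j$, $t\in A$, where $e_{ij}(t)$ is the identity matrix with its $(i,j)$ entry replaced by $t$. The group $E_n(A)$ acts on $\operatorname{Um}_{m,n}(A)$ by right multiplication, with orbit set $\operatorname{Um}_{m,n}(A)/E_n(A)$, and left multiplication by $E_m(A)$ on $\operatorname{Um}_{m,n}(A)$ induces an action of $E_m(A)$ on $\operatorname{Um}_{m,n}(A)/E_n(A)$. Then: (1) the action of $E_m(A)$ on $\operatorname{Um}_{m,n}(A)/E_n(A)$ by left multiplication is trivial; (2) if $M_1,M_2\in\operatorname{Um}_{m,n}(A)$ have a common right inverse, i.e. there is an $n\times m$ matrix $N$ with $M_1N=M_2N=I_m$, then $M_1$ and $M_2$ lie in the same $E_n(A)$-orbit. -/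

import Mathlib

/-- The elementary group `E_n(A)`: the subgroup of `SL_n(A)` generated by the elementary matrices
`e_{ij}(t) = 1 + t E_{ij}` with `i ≠ j` and `t ∈ A`. -/
def elementaryGroup (n : ℕ) (A : Type*) [CommRing A] :
    Subgroup (Matrix.SpecialLinearGroup (Fin n) A) :=
  Subgroup.closure {g | ∃ (i j : Fin n) (_ : i ≠ j) (t : A),
    (g : Matrix (Fin n) (Fin n) A) = Matrix.transvection i j t}

/-- The set `Um_{m,n}(A)` of unimodular matrices: the `m` by `n` matrices over `A` that have a
right inverse. -/
def Um (m n : ℕ) (A : Type*) [CommRing A] : Type _ :=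
  {M : Matrix (Fin m) (Fin n) A // ∃ N : Matrix (Fin n) (Fin m) A, M * N = 1}

namespace Um

variable {m n : ℕ} {A : Type*} [CommRing A]

/-- The underlying matrix of a unimodular matrix. -/
def toMatrix (M : Um m n A) : Matrix (Fin m) (Fin n) A := M.1

theorem ext {M₁ M₂ : Um m n A} (h : M₁.toMatrix = M₂.toMatrix) : M₁ = M₂ := Subtype.ext h

/-- `E_m(A)` acts on `Um_{m,n}(A)` by multiplication on the left: `g • M = g * M`. -/
instance leftAction : MulAction (elementaryGroup m A) (Um m n A) where
  smul g M := ⟨(g : Matrix.SpecialLinearGroup (Fin m) A).1 * M.toMatrix, by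
    obtain ⟨N, hN⟩ := M.2
    refine ⟨N * ((g : Matrix.SpecialLinearGroup (Fin m) A)⁻¹).1, ?_⟩
    have h := congrArg Subtype.val (mul_inv_cancel (g : Matrix.SpecialLinearGroup (Fin m) A))
    rw [Matrix.mul_assoc, ← Matrix.mul_assoc M.toMatrix N]
    change _ * (M.1 * N * _) = 1
    rw [hN, Matrix.one_mul]
    exact h⟩
  one_smul M := ext (Matrix.one_mul M.toMatrix)
  mul_smul g h M := ext (Matrix.mul_assoc (g : Matrix.SpecialLinearGroup (Fin m) A).1
    (h : Matrix.SpecialLinearGroup (Fin m) A).1 M.toMatrix)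

/-- `E_n(A)` acts on `Um_{m,n}(A)` by multiplication on the right: `op e • M = M * e`. -/
instance rightAction : MulAction (elementaryGroup n A)ᵐᵒᵖ (Um m n A) where
  smul e M := ⟨M.toMatrix * (e.unop : Matrix.SpecialLinearGroup (Fin n) A).1, by
    obtain ⟨N, hN⟩ := M.2
    refine ⟨((e.unop : Matrix.SpecialLinearGroup (Fin n) A)⁻¹).1 * N, ?_⟩
    have h := congrArg Subtype.val (mul_inv_cancel (e.unop : Matrix.SpecialLinearGroup (Fin n) A))
    change (e.unop : Matrix.SpecialLinearGroup (Fin n) A).1 *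
      ((e.unop : Matrix.SpecialLinearGroup (Fin n) A)⁻¹).1 = 1 at h
    rw [Matrix.mul_assoc, ← Matrix.mul_assoc _ _ N, h, Matrix.one_mul]
    exact hN⟩
  one_smul M := ext (Matrix.mul_one M.toMatrix)
  mul_smul e f M := ext (Matrix.mul_assoc M.toMatrix
    (f.unop : Matrix.SpecialLinearGroup (Fin n) A).1
    (e.unop : Matrix.SpecialLinearGroup (Fin n) A).1).symm

theorem toMatrix_smul (g : elementaryGroup m A) (M : Um m n A) :
    (g • M).toMatrix = (g : Matrix.SpecialLinearGroup (Fin m) A).1 * M.toMatrix := rfl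

theorem toMatrix_op_smul (e : elementaryGroup n A) (M : Um m n A) :
    (MulOpposite.op e • M).toMatrix =
      M.toMatrix * (e : Matrix.SpecialLinearGroup (Fin n) A).1 := rfl

theorem smul_op_smul (g : elementaryGroup m A) (e : (elementaryGroup n A)ᵐᵒᵖ) (M : Um m n A) :
    g • e • M = e • g • M :=
  ext (Matrix.mul_assoc (g : Matrix.SpecialLinearGroup (Fin m) A).1 M.toMatrix
    (e.unop : Matrix.SpecialLinearGroup (Fin n) A).1).symm

end Um

/-- The orbit set `Um_{m,n}(A)/E_n(A)` for right multiplication by `E_n(A)`. -/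
def UmOrbits (m n : ℕ) (A : Type*) [CommRing A] : Type _ :=
  MulAction.orbitRel.Quotient (elementaryGroup n A)ᵐᵒᵖ (Um m n A)

namespace UmOrbits

variable {m n : ℕ} {A : Type*} [CommRing A]

/-- The orbit of a unimodular matrix. -/
def mk (M : Um m n A) : UmOrbits m n A :=
  Quotient.mk (MulAction.orbitRel (elementaryGroup n A)ᵐᵒᵖ (Um m n A)) M

/-- The action of `E_m(A)` on `Um_{m,n}(A)/E_n(A)` by left multiplication:
`g • [M] = [g * M]`. -/
instance leftAction : MulAction (elementaryGroup m A) (UmOrbits m n A) where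
  smul g := Quotient.map (fun M => g • M) (by
    rintro _ M ⟨e, rfl⟩
    exact ⟨e, (Um.smul_op_smul g e M).symm⟩)
  one_smul x := by
    refine Quotient.inductionOn x fun M => ?_
    exact congrArg mk (one_smul (elementaryGroup m A) M)
  mul_smul g h x := by
    refine Quotient.inductionOn x fun M => ?_
    exact congrArg mk (mul_smul g h M)

theorem smul_mk (g : elementaryGroup m A) (M : Um m n A) : g • mk M = mk (g • M) := rfl

theorem mk_eq_mk_iff (M₁ M₂ : Um m n A) : mk M₁ = mk M₂ ↔
    ∃ e : elementaryGroup n A,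
      M₁.toMatrix * (e : Matrix.SpecialLinearGroup (Fin n) A).1 = M₂.toMatrix := by
  rw [eq_comm]
  refine Iff.trans Quotient.eq ⟨?_, ?_⟩
  · rintro ⟨e, he⟩
    exact ⟨e.unop, congrArg Um.toMatrix he⟩
  · rintro ⟨e, he⟩
    exact ⟨MulOpposite.op e, Um.ext he⟩

end UmOrbits

/-! Both claims reduce to Suslin's lemma: for `n ≥ 3`, a column `v` with `u v = 1` for some row `u`,
and a row `w` with `w v = 0`, the matrix `1 + v w` is elementary (`one_add_vecMulVec_mem`). It holds
because `u v = 1` makes `w` a sum of Koszul rows `a (v_j e_i - v_i e_j)`, each of which can be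
treated with a spare third coordinate. If `M N = 1`, then `e_ij(t) M = M (1 + t N_i M_j)`, with
`N_i` a column of `N` and `M_j` a row of `M`; this gives (1). If `M₁ N = M₂ N = 1`, then `M₁ (1 + N
(M₂ - M₁)) = M₂`, and the second factor is a product of matrices as in Suslin's lemma; this gives
(2). -/

/-- The matrices underlying the elements of `E_n(A)`, as a submonoid of `M_n(A)`. -/
def elementaryMatrices (n : ℕ) (A : Type*) [CommRing A] : Submonoid (Matrix (Fin n) (Fin n) A) :=
  (elementaryGroup n A).toSubmonoid.map Matrix.SpecialLinearGroup.coeMonoidHom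

section Suslin

open Matrix

variable {n : ℕ} {A : Type*} [CommRing A]

theorem mem_elementaryMatrices {X : Matrix (Fin n) (Fin n) A} :
    X ∈ elementaryMatrices n A ↔
      ∃ g : elementaryGroup n A, (g : SpecialLinearGroup (Fin n) A).1 = X := by
  refine Submonoid.mem_map.trans ⟨?_, ?_⟩
  · rintro ⟨g, hg, h⟩
    exact ⟨⟨g, hg⟩, h⟩
  · rintro ⟨g, h⟩
    exact ⟨g, g.2, h⟩

theorem transvection_mem_elementaryMatrices {i j : Fin n} (hij : i ≠ j) (t : A) :
    transvection i j t ∈ elementaryMatrices n A :=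
  mem_elementaryMatrices.2 ⟨⟨⟨transvection i j t, det_transvection_of_ne i j hij t⟩,
    Subgroup.subset_closure ⟨i, j, hij, t, rfl⟩⟩, rfl⟩

theorem one_add_vecMulVec_single_single_mem {i j : Fin n} (hij : i ≠ j) (a b : A) :
    1 + vecMulVec (Pi.single i a) (Pi.single j b) ∈ elementaryMatrices n A := by
  have h : vecMulVec (Pi.single i a) (Pi.single j b) = single i j (a * b) := by
    ext p q
    simp only [vecMulVec_apply, Pi.single_apply, Matrix.single_apply]
    grind
  rw [h]
  exact transvection_mem_elementaryMatrices hij (a * b)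

theorem one_add_mul_one_add {R : Type*} [Ring R] {x y : R} (h : x * y = 0) :
    (1 + x) * (1 + y) = 1 + (x + y) := by
  rw [mul_add, add_mul, add_mul, h, mul_one, mul_one, one_mul, add_zero, add_assoc]

/-- All cross terms vanish, so the sum is obtained by multiplying the factors `1 + X i`. -/
theorem one_add_sum_mem_elementaryMatrices {ι : Type*} (s : Finset ι)
    (X : ι → Matrix (Fin n) (Fin n) A) (hX : ∀ i j, X i * X j = 0)
    (h : ∀ i, 1 + X i ∈ elementaryMatrices n A) :
    1 + ∑ i ∈ s, X i ∈ elementaryMatrices n A := by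
  classical
  induction s using Finset.induction_on with
  | empty => simp
  | insert a s ha ih =>
    have := mul_mem (h a) ih
    have h0 : X a * ∑ i ∈ s, X i = 0 := by
      rw [Finset.mul_sum]
      exact Finset.sum_eq_zero fun i _ => hX a i
    rwa [one_add_mul_one_add h0, ← Finset.sum_insert ha] at this

theorem one_add_vecMulVec_single_mem {v : Fin n → A} {i : Fin n} (hv : v i = 0) (a : A) :
    1 + vecMulVec v (Pi.single i a) ∈ elementaryMatrices n A := by
  have key : vecMulVec v (Pi.single i a) = ∑ j, vecMulVec (Pi.single j (v j)) (Pi.single i a) := by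
    ext p q
    simp [Matrix.sum_apply, vecMulVec_apply, Pi.single_apply]
  rw [key]
  refine one_add_sum_mem_elementaryMatrices _ _ (fun j k => ?_) fun j => ?_
  · rw [vecMulVec_mul_vecMulVec, single_dotProduct]
    rcases eq_or_ne i k with rfl | h
    · simp [hv]
    · simp [h]
  · rcases eq_or_ne j i with rfl | h
    · simp [hv]
    · exact one_add_vecMulVec_single_single_mem h _ _

theorem one_add_single_vecMulVec_mem {w : Fin n → A} {i : Fin n} (hw : w i = 0) (a : A) :
    1 + vecMulVec (Pi.single i a) w ∈ elementaryMatrices n A := by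
  have key : vecMulVec (Pi.single i a) w = ∑ j, vecMulVec (Pi.single i a) (Pi.single j (w j)) := by
    ext p q
    simp [Matrix.sum_apply, vecMulVec_apply, Pi.single_apply]
  rw [key]
  refine one_add_sum_mem_elementaryMatrices _ _ (fun j k => ?_) fun j => ?_
  · rw [vecMulVec_mul_vecMulVec, single_dotProduct]
    rcases eq_or_ne j i with rfl | h
    · simp [hw]
    · simp [h]
  · rcases eq_or_ne i j with rfl | h
    · simp [hw]
    · exact one_add_vecMulVec_single_single_mem h _ _

/-- A rank one transvection whose vectors have a common zero coordinate is a commutator of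
elementary matrices. -/
theorem one_add_vecMulVec_mem_of_apply_eq_zero {v w : Fin n → A} {k : Fin n} (hv : v k = 0)
    (hw : w k = 0) (hwv : w ⬝ᵥ v = 0) : 1 + vecMulVec v w ∈ elementaryMatrices n A := by
  have h := mul_mem (mul_mem (one_add_vecMulVec_single_mem hv 1) (one_add_single_vecMulVec_mem hw 1))
    (mul_mem (one_add_vecMulVec_single_mem hv (-1)) (one_add_single_vecMulVec_mem hw (-1)))
  set α := vecMulVec v (Pi.single k (1 : A)) with hα
  set β := vecMulVec (Pi.single k (1 : A)) w with hβ
  have hα' : vecMulVec v (Pi.single k (-1 : A)) = -α := by rw [Pi.single_neg, vecMulVec_neg]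
  have hβ' : vecMulVec (Pi.single k (-1 : A)) w = -β := by rw [Pi.single_neg, neg_vecMulVec]
  have hαα : α * α = 0 := by simp [hα, vecMulVec_mul_vecMulVec, hv]
  have hββ : β * β = 0 := by simp [hβ, vecMulVec_mul_vecMulVec, hw]
  have hβα : β * α = 0 := by simp [hα, hβ, vecMulVec_mul_vecMulVec, hwv]
  have hαβ : α * β = vecMulVec v w := by simp [hα, hβ, vecMulVec_mul_vecMulVec]
  rw [hα', hβ'] at h
  convert h using 1
  -- Every term on the right except `1 + α * β` contains `α * α`, `β * β` or `β * α`.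
  have e : (1 + α) * (1 + β) * ((1 + -α) * (1 + -β)) =
      1 + α * β - α * α + (α * α) * β - β * α - β * β + (β * α) * β
        - α * (β * α) - α * (β * β) + α * (β * α) * β := by noncomm_ring
  rw [e, hαα, hββ, hβα, hαβ]
  simp

theorem one_add_vecMulVec_koszul_mem (hn : 3 ≤ n) (v : Fin n → A) (a : A) (i j : Fin n) :
    1 + vecMulVec v (Pi.single i (a * v j) - Pi.single j (a * v i)) ∈ elementaryMatrices n A := by
  rcases eq_or_ne i j with rfl | hij
  · simp
  -- The spare coordinate `k`, where `v'` below and the Koszul row both vanish, is where `n ≥ 3`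
  -- enters.
  obtain ⟨k, hk⟩ : ∃ k, k ∉ ({i, j} : Finset (Fin n)) := by
    by_contra! h
    have := Finset.card_le_card (fun x _ => h x : Finset.univ ⊆ ({i, j} : Finset (Fin n)))
    have := this.trans Finset.card_le_two
    simp at this
    omega
  simp only [Finset.mem_insert, Finset.mem_singleton, not_or] at hk
  -- Split `v` into `v'`, supported on `{i, j}` and still orthogonal to the row, and `v - v'`, which
  -- vanishes at `i` and `j`. The three resulting factors have vanishing cross terms.
  set v' : Fin n → A := Pi.single i (v i) + Pi.single j (v j) with hv'
  have hi : (v - v') i = 0 := by simp [hv', hij]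
  have hj : (v - v') j = 0 := by simp [hv', hij.symm]
  have h₁ : 1 + vecMulVec v' (Pi.single i (a * v j) - Pi.single j (a * v i)) ∈
      elementaryMatrices n A := by
    refine one_add_vecMulVec_mem_of_apply_eq_zero (k := k) ?_ ?_ ?_
    · simp [hv', hk.1, hk.2]
    · simp [hk.1, hk.2]
    · simp [hv', hij, hij.symm]
      ring
  have h := mul_mem (mul_mem (one_add_vecMulVec_single_mem hi (a * v j))
    (one_add_vecMulVec_single_mem hj (-(a * v i)))) h₁
  have hvi : v' i = v i := by simp [hv', hij]
  have hvj : v' j = v j := by simp [hv', hij.symm]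
  rw [one_add_mul_one_add, one_add_mul_one_add] at h
  · convert h using 2
    rw [Pi.single_neg, vecMulVec_neg, ← sub_eq_add_neg, ← vecMulVec_sub, ← add_vecMulVec,
      sub_add_cancel]
  · rw [add_mul, vecMulVec_mul_vecMulVec, vecMulVec_mul_vecMulVec, single_dotProduct,
      single_dotProduct, hvi, hvj, ← vecMulVec_add, ← add_smul]
    rw [show a * v j * v i + -(a * v i) * v j = 0 by ring, zero_smul, vecMulVec_zero]
  · rw [vecMulVec_mul_vecMulVec, single_dotProduct, hi, mul_zero, zero_smul, vecMulVec_zero]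

/-- Suslin's lemma: if `v` is unimodular and `w` is orthogonal to `v`, then `1 + v w` is a product
of elementary matrices of size at least three. -/
theorem one_add_vecMulVec_mem (hn : 3 ≤ n) {u v w : Fin n → A} (huv : u ⬝ᵥ v = 1)
    (hwv : w ⬝ᵥ v = 0) : 1 + vecMulVec v w ∈ elementaryMatrices n A := by
  -- Koszul decomposition with `a = w_i u_j`: the first terms sum to `(u v) w = w`, the second to
  -- `(w v) u = 0`.
  have key : vecMulVec v w = ∑ p : Fin n × Fin n, vecMulVec v
      (Pi.single p.1 (w p.1 * u p.2 * v p.2) - Pi.single p.2 (w p.1 * u p.2 * v p.1)) := by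
    ext a b
    simp only [Matrix.sum_apply, vecMulVec_apply, Pi.sub_apply, ← Finset.mul_sum,
      Finset.sum_sub_distrib, Fintype.sum_prod_type]
    have h₁ : ∑ i, ∑ j, Pi.single (M := fun _ => A) i (w i * u j * v j) b = w b := by
      rw [Finset.sum_comm]
      simp only [Finset.sum_pi_single, Finset.mem_univ, if_true, mul_assoc, ← Finset.mul_sum]
      exact (congrArg _ huv).trans (mul_one _)
    have h₂ : ∑ i, ∑ j, Pi.single (M := fun _ => A) j (w i * u j * v i) b = 0 := by
      simp only [Finset.sum_pi_single, Finset.mem_univ, if_true, mul_right_comm _ (u _),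
        ← Finset.sum_mul]
      exact (congrArg (· * u b) hwv).trans (zero_mul _)
    rw [h₁, h₂, sub_zero]
  rw [key]
  refine one_add_sum_mem_elementaryMatrices _ _ (fun p q => ?_) fun p =>
    one_add_vecMulVec_koszul_mem hn v _ _ _
  rw [vecMulVec_mul_vecMulVec]
  have : (Pi.single p.1 (w p.1 * u p.2 * v p.2) - Pi.single p.2 (w p.1 * u p.2 * v p.1)) ⬝ᵥ v
      = 0 := by
    simp only [sub_dotProduct, single_dotProduct]
    ring
  simp [this]

/-- If `N` has a left inverse and `D * N = 0`, then `1 + N * D` is a product of elementary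
matrices. -/
theorem one_add_mul_mem_elementaryMatrices (hn : 3 ≤ n) {m : ℕ} {M D : Matrix (Fin m) (Fin n) A}
    {N : Matrix (Fin n) (Fin m) A} (hM : M * N = 1) (hD : D * N = 0) :
    1 + N * D ∈ elementaryMatrices n A := by
  have hrow : ∀ k l, D.row k ⬝ᵥ N.col l = 0 := fun k l => congrFun (congrFun hD k) l
  have key : N * D = ∑ k, vecMulVec (N.col k) (D.row k) := by
    ext p q
    simp [Matrix.mul_apply, Matrix.sum_apply, vecMulVec_apply]
  rw [key]
  refine one_add_sum_mem_elementaryMatrices _ _ (fun k l => ?_) fun k =>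
    one_add_vecMulVec_mem hn (u := M.row k) ?_ (hrow k k)
  · rw [vecMulVec_mul_vecMulVec, hrow, zero_smul, vecMulVec_zero]
  · exact (congrFun (congrFun hM k) k).trans (one_apply_eq k)

/-- Multiplying `M` on the left by a transvection is the same as multiplying it on the right by
some product of elementary matrices. -/
theorem exists_mul_eq_transvection_mul (hn : 3 ≤ n) {m : ℕ} {M : Matrix (Fin m) (Fin n) A}
    {N : Matrix (Fin n) (Fin m) A} (hM : M * N = 1) {i j : Fin m} (hij : i ≠ j) (t : A) :
    ∃ X ∈ elementaryMatrices n A, M * X = transvection i j t * M := by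
  have hrow : ∀ k l, M.row k ⬝ᵥ N.col l = (1 : Matrix (Fin m) (Fin m) A) k l := fun k l =>
    congrFun (congrFun hM k) l
  refine ⟨1 + vecMulVec (N.col i) (t • M.row j),
    one_add_vecMulVec_mem hn (u := M.row i) ?_ ?_, ?_⟩
  · rw [hrow, one_apply_eq]
  · rw [smul_dotProduct, hrow, one_apply_ne hij.symm, smul_zero]
  · have hcol : M *ᵥ N.col i = Pi.single i 1 := by
      ext k
      rw [Pi.single_apply, ← one_apply]
      exact hrow k i
    rw [Matrix.mul_add, Matrix.mul_one, mul_vecMulVec, hcol, transvection, Matrix.add_mul,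
      Matrix.one_mul]
    congr 1
    ext p q
    rcases eq_or_ne p i with rfl | hp
    · simp [vecMulVec_apply]
    · simp [vecMulVec_apply, hp]

end Suslin

theorem UmOrbits.mk_eq_mk_of_mul_eq {m n : ℕ} {A : Type*} [CommRing A] {M₁ M₂ : Um m n A}
    {X : Matrix (Fin n) (Fin n) A} (hX : X ∈ elementaryMatrices n A)
    (h : M₁.toMatrix * X = M₂.toMatrix) : mk M₁ = mk M₂ := by
  obtain ⟨g, rfl⟩ := mem_elementaryMatrices.1 hX
  exact (mk_eq_mk_iff _ _).2 ⟨g, h⟩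

theorem UmOrbits.smul_eq_self_of_eq_transvection {m n : ℕ} {A : Type*} [CommRing A] (hn : 3 ≤ n)
    {g : elementaryGroup m A} {i j : Fin m} (hij : i ≠ j) {t : A}
    (hg : (g : Matrix.SpecialLinearGroup (Fin m) A).1 = Matrix.transvection i j t)
    (x : UmOrbits m n A) : g • x = x := by
  refine Quotient.inductionOn x fun M => ?_
  obtain ⟨N, hN⟩ := M.2
  obtain ⟨X, hX, h⟩ := exists_mul_eq_transvection_mul hn hN hij t
  refine (mk_eq_mk_of_mul_eq hX (h.trans ?_)).symm
  rw [Um.toMatrix_smul, hg]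
  rfl

theorem mainTheorem9 {A : Type*} [CommRing A] (m n : ℕ) (hmn : m < n) (hn : 3 ≤ n) :
    (∀ (g : elementaryGroup m A) (x : UmOrbits m n A), g • x = x) ∧
    (∀ (M₁ M₂ : Um m n A) (N : Matrix (Fin n) (Fin m) A),
      M₁.toMatrix * N = 1 → M₂.toMatrix * N = 1 →
        UmOrbits.mk M₁ = UmOrbits.mk M₂) := by
  refine ⟨fun g x => ?_, fun M₁ M₂ N h₁ h₂ => ?_⟩
  · have hle : (⊤ : Subgroup (elementaryGroup m A)) ≤ MulAction.stabilizer _ x := by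
      refine Subgroup.closure_closure_coe_preimage.ge.trans ((Subgroup.closure_le _).2 ?_)
      rintro g ⟨i, j, hij, t, hg⟩
      exact UmOrbits.smul_eq_self_of_eq_transvection hn hij hg x
    exact hle (Subgroup.mem_top g)
  · have hD : (M₂.toMatrix - M₁.toMatrix) * N = 0 := by rw [Matrix.sub_mul, h₁, h₂, sub_self]
    refine UmOrbits.mk_eq_mk_of_mul_eq (one_add_mul_mem_elementaryMatrices hn h₁ hD) ?_
    rw [Matrix.mul_add, Matrix.mul_one, ← Matrix.mul_assoc, h₁, Matrix.one_mul, add_sub_cancel]
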